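/- Fix real $M>1$ and an integer $n\ge 1$. Put $I=[0,\tfrac{(M-1)n}{(n-1)M}]$ if $n\ge2$ and $I=[0,\infty)$ if $n=1$. \emph{Stepsizes.} For every $v\in I$ there is exactly one pair $(\alpha,\beta)=(\alpha^*(v),\beta^*(v))\in\mathbb{R}^2$ with $\tfrac1M\le\alpha<1$ and $\tfrac{\alpha}{M}<\beta<\tfrac{M+1}{2M}$ that satisfies $$0=(M-1)Mn\alpha^3-(M+1)(M-2)n\alpha^2-(4n+(M-1)(n-1)v)\alpha+2n$$ and $$\begin{aligned}0={}&Mn\big((M-1)^2n+(1+M)^2(n-1)v\big)\big((M-1)\alpha+(1+M)\big)\beta^2\\&+2M\Big[2(M-1)Mn(-n+(n-1)v)\alpha^2+(1+M)(-n+(n-1)v)\big((3-M)n+(M-1)(n-1)v\big)\alpha\\&\qquad+n\big(n-(M-4)Mn-(1+M)(3+M)(n-1)v\big)\Big]\beta\\&+\Big[-2M(M^2-1)n(-n+(n-1)v)\alpha^2\\&\qquad+\big(2(2+M+2M^2-M^3)n^2+(M-3)(1+M)^2(n-1)nv+(1-M)(1+M)^2(n-1)^2v^2\big)\alpha\\&\qquad+2(1+M)^2n(-n+(n-1)v)\Big].\end{aligned}$$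 \emph{Worst-case error.} For $d\ge1$, $R,\sigma>0$ and stepsizes $\alpha,\beta>0$, let $W_d(\alpha,\beta;R,\sigma)$ be the supremum of $$\mathbb{E}\,\|x_2-x_*\|^2=\frac1{n^2}\sum_{i=1}^n\sum_{j=1}^n\big\|x_1^{(i)}-\beta\, g_j(x_1^{(i)})-x_*\big\|^2,\qquad x_1^{(i)}=x_0-\alpha\, g_i(x_0),$$ over all differentiable $1$-strongly convex $f:\mathbb{R}^d\to\mathbb{R}$ with $M$-Lipschitz gradient, all stochastic gradient oracles $g_1,\dots,g_n:\mathbb{R}^d\to\mathbb{R}^d$ (the $n$ values $g_i(x)$ being equally likely) with $\frac1n\sum_i g_i(x)=\nabla f(x)$ and $\frac1n\sum_i\|g_i(x)-\nabla f(x)\|^2\le\sigma^2$ for all $x\in\mathbb{R}^d$, and all $x_0,x_*\in\mathbb{R}^d$ with $\nabla f(x_*)=0$ and $\|x_0-x_*\|\le R$. \emph{Claim.} There is $\mathscr{U}(M,n)>0$, depending only on $M$ and $n$, such that for all $R,\sigma>0$ with $\sigma/R<\sqrt{\mathscr{U}(M,n)}$ there is $\bar v\in I$ such that, for every dimension $d\ge1$,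 both worst-case errors below are finite, the denominator is positive, and $$\frac{W_d(\alpha^*(\bar v),\beta^*(\bar v);R,\sigma)}{W_d(\tfrac{2}{M+1},\tfrac{2}{M+1};R,\sigma)}\le\mathscr{C}<1,\qquad \mathscr{C}=\frac12+\frac12\cdot\frac{(M+1)^4\big(\sqrt{2M^2-2M+1}-M\big)^2}{(M-1)^4\big(2+\sqrt{2M^2-2M+1}-M\big)^2}.$$ -/

import Mathlib

noncomputable section

namespace SilverSGD

/-- The Euclidean space `ℝ^d`. -/
abbrev Vec (d : ℕ) : Type := EuclideanSpace ℝ (Fin d)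

/-- The class of differentiable, `m`-strongly convex functions `ℝ^d → ℝ`
whose gradient is `M`-Lipschitz. -/
structure IsSmoothStronglyConvex {d : ℕ} (m M : ℝ) (f : Vec d → ℝ) : Prop where
  differentiable : Differentiable ℝ f
  strong : ∀ x y : Vec d,
    f x + inner ℝ (gradient f x) (y - x) + m / 2 * ‖y - x‖ ^ 2 ≤ f y
  lipschitz : ∀ x y : Vec d, ‖gradient f x - gradient f y‖ ≤ M * ‖x - y‖

/-- `g x 0, …, g x (n-1)` are the `n` equally likely realizations of the stochastic gradient
estimate at `x`; it is unbiased and its variance is at most `σ ^ 2`. -/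
structure IsStochasticOracle {d n : ℕ} (σ : ℝ) (f : Vec d → ℝ)
    (g : Vec d → Fin n → Vec d) : Prop where
  unbiased : ∀ x : Vec d, (1 / (n : ℝ)) • ∑ i, g x i = gradient f x
  variance : ∀ x : Vec d, (1 / (n : ℝ)) * ∑ i, ‖g x i - gradient f x‖ ^ 2 ≤ σ ^ 2

/-- One stochastic gradient step from `x` with stepsize `α`, when the `i`-th realization of the
estimate occurs. -/
def sgStep {d n : ℕ} (g : Vec d → Fin n → Vec d) (α : ℝ) (x : Vec d) (i : Fin n) : Vec d :=
  x - α • g x i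

/-- The expectation of `‖x₂ - x_*‖ ^ 2` after two stochastic gradient steps from `x₀` with stepsizes
`α`, `β`; the two samples are independent and uniform on `Fin n`. -/
def expectedError {d n : ℕ} (g : Vec d → Fin n → Vec d) (α β : ℝ) (x₀ xs : Vec d) : ℝ :=
  (1 / (n : ℝ) ^ 2) * ∑ i, ∑ j, ‖sgStep g β (sgStep g α x₀ i) j - xs‖ ^ 2

/-- All values of the expected two-step error over the feasible instances in dimension `d`:
objective functions, oracles with `n` realizations and variance at most `σ ^ 2`, minimizers `xs`,
and initial points within distance `R` of `xs`. -/
def errorValues (d n : ℕ) (m M R σ α β : ℝ) : Set ℝ :=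
  {e | ∃ (f : Vec d → ℝ) (g : Vec d → Fin n → Vec d) (x₀ xs : Vec d),
    IsSmoothStronglyConvex m M f ∧ IsStochasticOracle σ f g ∧
    gradient f xs = 0 ∧ ‖x₀ - xs‖ ^ 2 ≤ R ^ 2 ∧
    e = expectedError g α β x₀ xs}

/-- The worst-case expected two-step error (the optimal value of the performance estimation
problem). -/
def worstCase (d n : ℕ) (m M R σ α β : ℝ) : ℝ :=
  sSup (errorValues d n m M R σ α β)

/-- The admissible range `[0, (M-1)n / ((n-1)M)]` of the parameter `v`, which is `[0, ∞)` if
`n = 1`. -/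
def admissible (M : ℝ) (n : ℕ) : Set ℝ :=
  {v | 0 ≤ v ∧ (n ≠ 1 → v ≤ (M - 1) * n / (((n : ℝ) - 1) * M))}

/-- The left-hand side of the cubic equation for `α`. -/
def alphaPoly (M n v α : ℝ) : ℝ :=
  (M - 1) * M * n * α ^ 3 - (M + 1) * (M - 2) * n * α ^ 2
    - (4 * n + (M - 1) * (n - 1) * v) * α + 2 * n

/-- The left-hand side of the equation, quadratic in `β`, which links `α` and `β`. -/
def betaPoly (M n v α β : ℝ) : ℝ :=
  M * n * ((-1 + M) ^ 2 * n + (1 + M) ^ 2 * (-1 + n) * v) * ((-1 + M) * α + (1 + M)) * β ^ 2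
  + 2 * M *
    (2 * (-1 + M) * M * n * (-n + (n - 1) * v) * α ^ 2
      + (1 + M) * (-n + (n - 1) * v) * ((3 - M) * n + (-1 + M) * (-1 + n) * v) * α
      + n * (n - (M - 4) * M * n - (1 + M) * (3 + M) * (-1 + n) * v)) * β
  + (-2 * M * (-1 + M ^ 2) * n * (-n + (n - 1) * v) * α ^ 2
      + (2 * (2 + M + 2 * M ^ 2 - M ^ 3) * n ^ 2
          + (-3 + M) * (1 + M) ^ 2 * (-1 + n) * n * v
          + (1 - M) * (1 + M) ^ 2 * (-1 + n) ^ 2 * v ^ 2) * α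
      + 2 * (1 + M) ^ 2 * n * (-n + (n - 1) * v))

/-- `(α, β)` is a two-step stepsize schedule `(α*(v), β*(v))` for the parameters `M`, `n`, `v`. -/
structure IsSchedule (M : ℝ) (n : ℕ) (v α β : ℝ) : Prop where
  alpha_mem : α ∈ Set.Ico (1 / M) 1
  beta_mem : β ∈ Set.Ioo (α / M) ((M + 1) / (2 * M))
  alpha_eq : alphaPoly M n v α = 0
  beta_eq : betaPoly M n v α β = 0

/-- The contraction factor `𝒞` of the comparison. -/
def ratioBound (M : ℝ) : ℝ :=
  1 / 2 + 1 / 2 * (((M + 1) ^ 4 * (√(2 * M ^ 2 - 2 * M + 1) - M) ^ 2) /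
    ((M - 1) ^ 4 * (2 + √(2 * M ^ 2 - 2 * M + 1) - M) ^ 2))

end SilverSGD

end

/-! The parameter `v = 0` works for every small noise level. There `(α, β)` are the two-step silver
stepsizes, and two exact gradient steps contract the distance to the minimizer by a factor `ρ` with
`ρ < q ^ 2`, where `q = (M - 1) / (M + 1)` (`norm_two_steps_le`, `silver_rate_lt`). With both
stepsizes `2 / (M + 1)`, the instance `‖·‖ ^ 2 / 2` with exact gradients already has error `q ^ 4 *
R ^ 2`, so the denominator is at least that. Noise perturbs the silver error continuously: by
Young's inequality it is at most `(1 + ε) * ρ ^ 2 * R ^ 2 + C * σ ^ 2` (`expectedError_le`). For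
suitable `ε` and small `σ / R` this stays below the midpoint `(ρ ^ 2 + q ^ 4) / 2 * R ^ 2`, and `𝒞`
is that midpoint divided by `q ^ 4`.

Existence and uniqueness of the schedule for every `v` is separate: a cubic with a single root in
the range of `α`, then a quadratic that changes sign over the range of `β`. All square roots
disappear under a rational parametrization by `t`. -/

namespace SilverSGD

/-! ### Contraction of two noiseless silver steps -/

/-- The dual certificate of the two-step silver rate, on the level of the Gram matrix. -/
theorem silver_certificate {t α β H₀ H₁ Hs a b c u v w : ℝ} (ht : 0 < t)
    (hE : 0 < 1 - 2 * t - t ^ 2) (hα : α = (1 - 2 * t - t ^ 2) / (1 - t))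
    (hβ : β = (1 - 2 * t - t ^ 2) / ((1 + t) * (1 - 2 * t)))
    (q01 : b - 2 * w + c ≤ 2 * (2 * t / (1 - 2 * t - t ^ 2)) * (H₀ - H₁ - (v - ((1 - α) * v - α * w))))
    (q10 : c - 2 * w + b ≤ 2 * (2 * t / (1 - 2 * t - t ^ 2)) * (H₁ - H₀ - ((1 - α) * u - α * b - u)))
    (qs0 : b ≤ 2 * (2 * t / (1 - 2 * t - t ^ 2)) * (Hs - H₀ + u))
    (qs1 : c ≤ 2 * (2 * t / (1 - 2 * t - t ^ 2)) * (Hs - H₁ + ((1 - α) * v - α * w)))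
    (q1s : c ≤ 2 * (2 * t / (1 - 2 * t - t ^ 2)) * (H₁ - Hs)) :
    (1 - β) ^ 2 * ((1 - α) ^ 2 * a - 2 * (1 - α) * α * u + α ^ 2 * b)
      - 2 * β * (1 - β) * ((1 - α) * v - α * w) + β ^ 2 * c ≤ (t ^ 2 / (1 - 2 * t)) ^ 2 * a := by
  have ht2 : 0 < 1 - 2 * t := by nlinarith
  have ht1 : 0 < 1 - t := by linarith
  -- `K` is a common scale of the five multipliers. They form a circulation on the points `0`, `1`,
  -- `s`, so `H₀`, `H₁`, `Hs` cancel in the weighted sum, which then equals the claim exactly, with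
  -- no square left over.
  obtain ⟨K, hK⟩ : ∃ K, K = (1 - 2 * t - t ^ 2) ^ 2 / (2 * (1 - 2 * t) ^ 2 * (1 + t) ^ 2) := ⟨_, rfl⟩
  have hK0 : 0 ≤ K := by rw [hK]; positivity
  have hw : 0 ≤ 1 - t ^ 2 * (1 + t) / (1 - t) := by
    rw [sub_nonneg, div_le_one ht1]; nlinarith
  have i01 := mul_le_mul_of_nonneg_left q01
    (show 0 ≤ (1 + t) / (1 - t) * (t ^ 2 * K) by positivity)
  have i10 := mul_le_mul_of_nonneg_left q10 (show 0 ≤ t ^ 2 * K by positivity)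
  have is0 := mul_le_mul_of_nonneg_left qs0
    (show 0 ≤ 2 * t / (1 - t) * (t ^ 2 * K) by positivity)
  have is1 := mul_le_mul_of_nonneg_left qs1 (mul_nonneg hK0 hw)
  have i1s := mul_le_mul_of_nonneg_left q1s
    (show 0 ≤ 2 * t / (1 - t) * (t ^ 2 * K) + K * (1 - t ^ 2 * (1 + t) / (1 - t)) from
      add_nonneg (by positivity) (mul_nonneg hK0 hw))
  have hsum := add_le_add (add_le_add (add_le_add i01 i10) (add_le_add is0 is1)) i1s
  rw [← sub_nonneg] at hsum ⊢
  refine hsum.trans_eq ?_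
  have n1 := ht1.ne'
  have n2 := ht2.ne'
  have n3 := hE.ne'
  have n4 : 1 + t ≠ 0 := by positivity
  rw [hK, hβ, hα]
  -- The denominators become atoms, so that `field_simp` clears them by the nonvanishing facts at
  -- hand; they are expanded again only for `ring`.
  generalize hE' : 1 - 2 * t - t ^ 2 = E at n3 ⊢
  generalize hp : 1 - 2 * t = p at n2 ⊢
  generalize ho : 1 - t = o at n1 ⊢
  field_simp
  subst hE' hp ho
  ring

namespace IsSmoothStronglyConvex

variable {d : ℕ} {m M : ℝ} {f : Vec d → ℝ}

/-- The quadratic upper bound for a function with Lipschitz gradient. -/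
theorem le_quadratic (hf : IsSmoothStronglyConvex m M f) (x y : Vec d) :
    f y ≤ f x + inner ℝ (gradient f x) (y - x) + M / 2 * ‖y - x‖ ^ 2 := by
  have hline : ∀ s : ℝ, HasDerivAt (fun s : ℝ => x + s • (y - x)) (y - x) s := fun s => by
    simpa using ((hasDerivAt_id s).smul_const (y - x)).const_add x
  have hφ : ∀ s : ℝ, HasDerivAt
      (fun s : ℝ => f (x + s • (y - x)) - s * inner ℝ (gradient f x) (y - x)
        - M / 2 * ‖y - x‖ ^ 2 * s ^ 2)
      (inner ℝ (gradient f (x + s • (y - x))) (y - x) - inner ℝ (gradient f x) (y - x)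
        - M / 2 * ‖y - x‖ ^ 2 * (2 * s)) s := fun s => by
    have h1 := (hf.differentiable (x + s • (y - x))).hasGradientAt.hasFDerivAt.comp_hasDerivAt s
      (hline s)
    have h2 := (hasDerivAt_id s).mul_const (inner ℝ (gradient f x) (y - x))
    have h3 := ((hasDerivAt_id s).pow 2).const_mul (M / 2 * ‖y - x‖ ^ 2)
    refine ((h1.sub h2).sub h3).congr_deriv ?_
    simp
  have hanti := antitoneOn_of_deriv_nonpos (convex_Icc (0 : ℝ) 1)
    (fun s _ => (hφ s).continuousAt.continuousWithinAt)
    (fun s _ => (hφ s).differentiableAt.differentiableWithinAt) (fun s hs => by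
      rw [interior_Icc] at hs
      rw [(hφ s).deriv, ← inner_sub_left]
      have h1 := real_inner_le_norm (gradient f (x + s • (y - x)) - gradient f x) (y - x)
      have h2 := hf.lipschitz (x + s • (y - x)) x
      rw [add_sub_cancel_left, norm_smul, Real.norm_of_nonneg hs.1.le] at h2
      nlinarith [mul_le_mul_of_nonneg_right h2 (norm_nonneg (y - x))])
  have := hanti (Set.left_mem_Icc.2 zero_le_one) (Set.right_mem_Icc.2 zero_le_one) zero_le_one
  simp only [one_smul, zero_smul, add_zero, add_sub_cancel, one_mul, zero_mul, one_pow, mul_one,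
    ne_eq, OfNat.ofNat_ne_zero, not_false_eq_true, zero_pow, mul_zero, sub_zero] at this
  linarith

/-- The interpolation inequality of smooth strongly convex functions, written for the convex
function `f - m / 2 * ‖·‖ ^ 2`. -/
theorem interpolation (hf : IsSmoothStronglyConvex m M f) (hm : m < M) (x y : Vec d) :
    ‖(gradient f x - m • x) - (gradient f y - m • y)‖ ^ 2 ≤
      2 * (M - m) * ((f x - m / 2 * ‖x‖ ^ 2) - (f y - m / 2 * ‖y‖ ^ 2)
        - inner ℝ (gradient f y - m • y) (x - y)) := by
  have hL : 0 < M - m := sub_pos.2 hm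
  set q := (gradient f x - m • x) - (gradient f y - m • y) with hq
  set c := (M - m)⁻¹ with hc
  have hcL : c * (M - m) = 1 := inv_mul_cancel₀ hL.ne'
  -- The test point is a gradient step of length `1 / (M - m)` from `x` for `h - ⟪∇h y, ·⟫`, where
  -- `h = f - m / 2 * ‖·‖ ^ 2`. Comparing the lower bound based at `y` with the upper bound based at
  -- `x` there gives the inequality.
  have h1 := hf.strong y (x - c • q)
  have h2 := hf.le_quadratic x (x - c • q)
  have hx : gradient f x = q + (gradient f y - m • y) + m • x := by rw [hq]; abel
  set p := gradient f y - m • y with hp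
  have hy : gradient f y = p + m • y := by rw [hp]; abel
  rw [hx] at h2
  rw [hy] at h1
  clear_value q p
  clear hx hy
  have e1 : ‖x - c • q - y‖ ^ 2 = ‖x‖ ^ 2 + ‖y‖ ^ 2 + c ^ 2 * ‖q‖ ^ 2 - 2 * inner ℝ x y
      - 2 * c * inner ℝ q x + 2 * c * inner ℝ q y := by
    simp only [← real_inner_self_eq_norm_sq, inner_sub_left, inner_sub_right, real_inner_smul_left,
      real_inner_smul_right, real_inner_comm x y, real_inner_comm q x, real_inner_comm q y]
    ring
  have e2 : ‖x - c • q - x‖ ^ 2 = c ^ 2 * ‖q‖ ^ 2 := by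
    rw [sub_right_comm, sub_self, zero_sub, norm_neg, norm_smul, mul_pow, Real.norm_eq_abs, sq_abs]
  rw [e1] at h1
  rw [e2] at h2
  simp only [inner_sub_right, inner_add_left, real_inner_smul_left, real_inner_smul_right,
    real_inner_self_eq_norm_sq, real_inner_comm x y, real_inner_comm q x, real_inner_comm q y]
    at h1 h2 ⊢
  have key : c * ‖q‖ ^ 2 ≤ 2 * ((f x - m / 2 * ‖x‖ ^ 2) - (f y - m / 2 * ‖y‖ ^ 2)
      - (inner ℝ p x - inner ℝ p y)) := by
    have e3 : c ^ 2 * ‖q‖ ^ 2 * (M - m) = c * ‖q‖ ^ 2 := by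
      rw [show c ^ 2 * ‖q‖ ^ 2 * (M - m) = c * (M - m) * (c * ‖q‖ ^ 2) by ring, hcL, one_mul]
    simp only [real_inner_comm] at h1 h2 ⊢
    nlinarith
  calc ‖q‖ ^ 2 = (M - m) * (c * ‖q‖ ^ 2) := by
        rw [← mul_assoc, mul_comm (M - m), hcL, one_mul]
    _ ≤ _ := by
        have := mul_le_mul_of_nonneg_left key hL.le
        linarith

/-- The interpolation inequality for `m = 1`, with the quadratic centred at `c`. -/
theorem interpolation_centered (hf : IsSmoothStronglyConvex 1 M f) (hM : 1 < M) {x y c p q : Vec d}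
    (hp : gradient f x = p + (x - c)) (hq : gradient f y = q + (y - c)) :
    ‖p - q‖ ^ 2 ≤ 2 * (M - 1) * ((f x - 1 / 2 * ‖x - c‖ ^ 2) - (f y - 1 / 2 * ‖y - c‖ ^ 2)
        - inner ℝ q (x - y)) := by
  have h := hf.interpolation hM x y
  rw [hp, hq] at h
  have e1 : p + (x - c) - (1 : ℝ) • x - (q + (y - c) - (1 : ℝ) • y) = p - q := by
    rw [one_smul, one_smul]; abel
  have e2 : q + (y - c) - (1 : ℝ) • y = q - c := by rw [one_smul]; abel
  rw [e1, e2] at h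
  -- Moving the centre changes the subtracted quadratic by an affine function, which the right-hand
  -- side does not see.
  refine h.trans_eq ?_
  rw [norm_sub_sq_real, norm_sub_sq_real, inner_sub_left, inner_sub_right c,
    real_inner_comm x c, real_inner_comm y c]
  ring

/-- Two gradient steps with the silver stepsizes, in the rational parametrization by `t`. -/
theorem norm_two_steps_le {t : ℝ} (ht : 0 < t) (hE : 0 < 1 - 2 * t - t ^ 2)
    (hf : IsSmoothStronglyConvex 1 ((1 - t ^ 2) / (1 - 2 * t - t ^ 2)) f)
    {xs : Vec d} (hxs : gradient f xs = 0) {x₀ x₁ : Vec d}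
    (hx₁ : x₁ = x₀ - ((1 - 2 * t - t ^ 2) / (1 - t)) • gradient f x₀) :
    ‖x₁ - ((1 - 2 * t - t ^ 2) / ((1 + t) * (1 - 2 * t))) • gradient f x₁ - xs‖ ≤
      t ^ 2 / (1 - 2 * t) * ‖x₀ - xs‖ := by
  have ht2 : 0 < 1 - 2 * t := by nlinarith
  have ht1 : 0 < 1 - t := by linarith
  obtain ⟨M, hM⟩ : ∃ M, M = (1 - t ^ 2) / (1 - 2 * t - t ^ 2) := ⟨_, rfl⟩
  rw [← hM] at hf
  have hL : M - 1 = 2 * t / (1 - 2 * t - t ^ 2) := by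
    rw [hM, eq_div_iff hE.ne', sub_mul, div_mul_cancel₀ _ hE.ne']; ring
  have hm : 1 < M := by
    have : 0 < 2 * t / (1 - 2 * t - t ^ 2) := by positivity
    linarith
  obtain ⟨p₀, hp₀⟩ : ∃ p, gradient f x₀ = p + (x₀ - xs) := ⟨gradient f x₀ - (x₀ - xs), by abel⟩
  obtain ⟨p₁, hp₁⟩ : ∃ p, gradient f x₁ = p + (x₁ - xs) := ⟨gradient f x₁ - (x₁ - xs), by abel⟩
  have hps : gradient f xs = 0 + (xs - xs) := by rw [hxs]; simp
  have q01 := hf.interpolation_centered hm hp₀ hp₁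
  have q10 := hf.interpolation_centered hm hp₁ hp₀
  have qs0 := hf.interpolation_centered hm hps hp₀
  have qs1 := hf.interpolation_centered hm hps hp₁
  have q1s := hf.interpolation_centered hm hp₁ hps
  rw [hL] at q01 q10 qs0 qs1 q1s
  rw [hp₀] at hx₁
  rw [hp₁]
  clear hp₀ hp₁ hps hxs hM hf hL hm
  obtain ⟨z, rfl⟩ : ∃ z, x₀ = z + xs := ⟨x₀ - xs, by abel⟩
  obtain ⟨α, hα⟩ : ∃ α, α = (1 - 2 * t - t ^ 2) / (1 - t) := ⟨_, rfl⟩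
  obtain ⟨β, hβ⟩ : ∃ β, β = (1 - 2 * t - t ^ 2) / ((1 + t) * (1 - 2 * t)) := ⟨_, rfl⟩
  rw [← hα] at hx₁
  rw [← hβ]
  have hy : x₁ = ((1 - α) • z - α • p₀) + xs := by
    rw [hx₁]; module
  subst hy
  clear hx₁
  simp only [add_sub_cancel_right, sub_self, zero_sub, sub_zero, norm_zero, norm_neg,
    sub_add_cancel_right, inner_zero_left, add_sub_add_right_eq_sub] at q01 q10 qs0 qs1 q1s ⊢
  rw [show (1 - α) • z - α • p₀ + xs - β • (p₁ + ((1 - α) • z - α • p₀)) - xs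
    = (1 - β) • ((1 - α) • z - α • p₀) - β • p₁ by module]
  set H₀ := f (z + xs)
  set H₁ := f ((1 - α) • z - α • p₀ + xs)
  set Hs := f xs
  refine le_of_sq_le_sq ?_ (by positivity)
  have e2 : ‖(1 - β) • ((1 - α) • z - α • p₀) - β • p₁‖ ^ 2 =
      (1 - β) ^ 2 * ((1 - α) ^ 2 * ‖z‖ ^ 2 - 2 * (1 - α) * α * inner ℝ z p₀ + α ^ 2 * ‖p₀‖ ^ 2)
      - 2 * β * (1 - β) * ((1 - α) * inner ℝ z p₁ - α * inner ℝ p₀ p₁) + β ^ 2 * ‖p₁‖ ^ 2 := by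
    simp only [norm_sub_sq_real ((1 - β) • _), norm_sub_sq_real ((1 - α) • _), norm_smul, mul_pow,
      inner_sub_left, real_inner_smul_left, real_inner_smul_right, Real.norm_eq_abs,
      sq_abs]
    ring
  rw [e2, mul_pow]
  simp only [norm_sub_sq_real p₀, norm_sub_sq_real p₁, norm_sub_sq_real ((1 - α) • _), norm_smul,
    mul_pow, Real.norm_eq_abs, sq_abs, inner_sub_right, inner_neg_right, real_inner_smul_right,
    real_inner_smul_left, real_inner_self_eq_norm_sq, real_inner_comm z p₀, real_inner_comm z p₁,
    real_inner_comm p₀ p₁] at q01 q10 qs0 qs1 q1s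
  refine silver_certificate (H₀ := H₀ - 1 / 2 * ‖z‖ ^ 2) (H₁ := H₁ - 1 / 2 * ((1 - α) ^ 2 * ‖z‖ ^ 2
    - 2 * (α * ((1 - α) * inner ℝ z p₀)) + α ^ 2 * ‖p₀‖ ^ 2)) (Hs := Hs) ht hE hα hβ ?_ ?_ ?_ ?_ ?_
  all_goals linarith

end IsSmoothStronglyConvex

/-! ### Roots of the equations for `α` and `β` -/

/-- A cubic which is positive at `0`, grows at infinity and is nonpositive at `1` has at most one
zero in `(0, 1)`. -/
theorem cubic_root_unique {A B C D x y : ℝ} (hA : 0 < A) (hD : 0 < D)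
    (h1 : A - B - C + D ≤ 0) (hx : 0 < x) (hxy : x < y) (hy : y < 1)
    (ex : A * x ^ 3 - B * x ^ 2 - C * x + D = 0)
    (ey : A * y ^ 3 - B * y ^ 2 - C * y + D = 0) : False := by
  have hy0 : 0 < y := hx.trans hxy
  -- For roots `x`, `y` of the cubic `P`, Vieta gives the third root `-D / (A * x * y)`, hence `P 1
  -- = A * (1 - x) * (1 - y) * (1 + D / (A * x * y)) > 0`. This is that identity before `P x = P y =
  -- 0` is used.
  have key : x * y * (A - B - C + D) = (1 - x) * (1 - y) * (A * (x * y) + D)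
      + ((A * y ^ 3 - B * y ^ 2 - C * y + D) * (x * (1 - x))
        - (A * x ^ 3 - B * x ^ 2 - C * x + D) * (y * (1 - y))) / (y - x) := by
    field_simp [(sub_pos.2 hxy).ne']
    ring
  rw [ex, ey] at key
  have : 0 < (1 - x) * (1 - y) * (A * (x * y) + D) := by
    have := sub_pos.2 hy; have := sub_pos.2 (hxy.trans hy); positivity
  have : x * y * (A - B - C + D) ≤ 0 := mul_nonpos_of_nonneg_of_nonpos (by positivity) h1
  simp only [zero_mul, sub_self, zero_div, add_zero] at key
  linarith

/-- A quadratic with positive leading coefficient that changes sign from negative to positive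
between `l` and `u` has exactly one zero there. -/
theorem existsUnique_quadratic_root {A B C l u : ℝ} (hA : 0 < A) (hlu : l < u)
    (hl : A * l ^ 2 + B * l + C < 0) (hu : 0 < A * u ^ 2 + B * u + C) :
    ∃! x, x ∈ Set.Ioo l u ∧ A * x ^ 2 + B * x + C = 0 := by
  obtain ⟨x, hx, ex⟩ := intermediate_value_Ioo (f := fun x => A * x ^ 2 + B * x + C) hlu.le
    (by fun_prop) ⟨hl, hu⟩
  refine ⟨x, ⟨hx, ex⟩, ?_⟩
  have aux : ∀ x y : ℝ, x ∈ Set.Ioo l u → x < y → A * x ^ 2 + B * x + C = 0 →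
      A * y ^ 2 + B * y + C = 0 → False := by
    intro x y hx hxy ex ey
    have h0 : A * (x + y) + B = 0 := by
      have : (y - x) * (A * (x + y) + B) = 0 := by linear_combination ey - ex
      exact (mul_eq_zero.1 this).resolve_left (sub_pos.2 hxy).ne'
    have : 0 < A * ((x - l) * (y - l)) :=
      mul_pos hA (mul_pos (sub_pos.2 hx.1) (sub_pos.2 (hx.1.trans hxy)))
    have h2 : A * l ^ 2 + B * l + C = A * ((x - l) * (y - l)) := by
      linear_combination (l - x) * h0 + ex
    linarith
  rintro y ⟨hy, ey⟩
  rcases lt_trichotomy x y with h | h | h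
  · exact (aux x y hx h ex ey).elim
  · exact h.symm
  · exact (aux y x hy h ey ex).elim

/-- Up to scaling, `n` and `v` enter only through `w = (n - 1) * v / n`; this and `betaPoly_eq`
reduce everything to `n = 2`, `v = 2 * w`. -/
theorem alphaPoly_eq (M n v α : ℝ) (hn : n ≠ 0) :
    alphaPoly M n v α = n * alphaPoly M 2 (2 * ((n - 1) * v / n)) α / 2 := by
  unfold alphaPoly; field_simp; ring

theorem betaPoly_eq (M n v α β : ℝ) (hn : n ≠ 0) :
    betaPoly M n v α β = n ^ 2 * betaPoly M 2 (2 * ((n - 1) * v / n)) α β / 4 := by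
  unfold betaPoly; field_simp; ring

/-- The quadratic in `β` at the upper end of the admissible interval. -/
theorem betaPoly_upper {M w α : ℝ} (hM : 1 < M) (h : alphaPoly M 2 (2 * w) α = 0) :
    betaPoly M 2 (2 * w) α ((M + 1) / (2 * M)) =
      (M - 1) ^ 2 / (4 * M ^ 2) *
        (4 * M * ((M - 1) ^ 2 + (1 + M) ^ 2 * w) * ((M - 1) * α + (1 + M))) := by
  have hM0 : M ≠ 0 := by positivity
  have hM1 : M - 1 ≠ 0 := (sub_pos.2 hM).ne'
  have hα : α ≠ 0 := by
    rintro rfl; simp [alphaPoly] at h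
  -- The cubic is linear in `w`, so `w` can be eliminated. The value found is `((M - 1) / (2 * M)) ^
  -- 2` times the leading coefficient of the quadratic.
  have hw : w = ((M - 1) * M * α ^ 3 - (M + 1) * (M - 2) * α ^ 2 - 4 * α + 2) / ((M - 1) * α) := by
    rw [eq_div_iff (mul_ne_zero hM1 hα)]
    unfold alphaPoly at h
    linarith
  rw [hw]
  unfold betaPoly
  field_simp
  ring

/-- The quadratic in `β` is negative at the lower end of the admissible interval. -/
theorem betaPoly_lower_neg {M w α : ℝ} (hM : 1 < M) (hα : 1 / M ≤ α) (hα1 : α < 1) (hw : 0 ≤ w)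
    (h : alphaPoly M 2 (2 * w) α = 0) :
    betaPoly M 2 (2 * w) α (α / M) < 0 := by
  obtain ⟨k, rfl⟩ : ∃ k, M = 1 + k := ⟨M - 1, by ring⟩
  obtain ⟨s, rfl⟩ : ∃ s, α = (1 + s) / (1 + k) :=
    ⟨(1 + k) * α - 1, by field_simp [(zero_lt_one.trans hM).ne']; ring⟩
  have hk : 0 < k := by linarith
  have hk1 : 0 < 1 + k := by linarith
  have hs : 0 ≤ s := by
    have := (div_le_div_iff_of_pos_right hk1).1 hα; linarith
  have hs1 : 0 < 1 + s := by linarith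
  have hsk : s < k := by
    have := (div_lt_one hk1).1 hα1; linarith
  have hsk' : k - s ≠ 0 := (sub_pos.2 hsk).ne'
  have hwk : w * ((1 + k) * k * (1 + s)) = (k - s) * (k - 2 * s - 2 * k * s - k * s ^ 2) := by
    unfold alphaPoly at h
    field_simp at h
    linear_combination (-1 / 2) * h
  have hj : 2 * s ≤ k := by
    have h1 : 0 ≤ (k - s) * (k - 2 * s - 2 * k * s - k * s ^ 2) := by rw [← hwk]; positivity
    have h2 : 0 ≤ k - 2 * s - 2 * k * s - k * s ^ 2 :=
      nonneg_of_mul_nonneg_right h1 (sub_pos.2 hsk)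
    have : 0 ≤ 2 * k * s + k * s ^ 2 := by positivity
    linarith
  have hw' : w = (k - s) * (k - 2 * s - 2 * k * s - k * s ^ 2) / ((1 + k) * k * (1 + s)) := by
    rw [eq_div_iff (by positivity)]; exact hwk
  -- Since `w ≥ 0` forces `2 * s ≤ k`, the feasible region lies in `s, j ≥ 0`; in these variables
  -- every coefficient of the large factor is positive.
  obtain ⟨j, rfl⟩ : ∃ j, k = 2 * s + j := ⟨k - 2 * s, by ring⟩
  have hj0 : 0 ≤ j := by linarith
  have key : betaPoly (1 + (2 * s + j)) 2 (2 * w) ((1 + s) / (1 + (2 * s + j)))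
      ((1 + s) / (1 + (2 * s + j)) / (1 + (2 * s + j))) =
      -(4 * (1 + s) * (s + j) / ((2 * s + j) * (1 + (2 * s + j)) ^ 5)) *
      (
    32 * s ^ 2 + 192 * s ^ 3 + 496 * s ^ 4 + 800 * s ^ 5 + 864 * s ^ 6 + 624 * s ^ 7 + 288 *
      s ^ 8 + 64 * s ^ 9 + 56 * s * j + 448 * s ^ 2 * j + 1416 * s ^ 3 * j + 2608 * s ^ 4 *
      j + 3096 * s ^ 5 * j + 2408 * s ^ 6 * j + 1152 * s ^ 7 * j + 256 * s ^ 8 * j + 24 * j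
      ^ 2 + 332 * s * j ^ 2 + 1436 * s ^ 2 * j ^ 2 + 3216 * s ^ 3 * j ^ 2 + 4360 * s ^ 4 * j
      ^ 2 + 3748 * s ^ 5 * j ^ 2 + 1904 * s ^ 6 * j ^ 2 + 432 * s ^ 7 * j ^ 2 + 78 * j ^ 3 +
      618 * s * j ^ 3 + 1892 * s ^ 2 * j ^ 3 + 3110 * s ^ 3 * j ^ 3 + 3062 * s ^ 4 * j ^ 3 +
      1696 * s ^ 5 * j ^ 3 + 400 * s ^ 6 * j ^ 3 + 96 * j ^ 4 + 534 * s * j ^ 4 + 1186 * s ^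
      2 * j ^ 4 + 1412 * s ^ 3 * j ^ 4 + 882 * s ^ 4 * j ^ 4 + 220 * s ^ 5 * j ^ 4 + 58 * j
      ^ 5 + 228 * s * j ^ 5 + 362 * s ^ 2 * j ^ 5 + 268 * s ^ 3 * j ^ 5 + 72 * s ^ 4 * j ^ 5
      + 17 * j ^ 6 + 46 * s * j ^ 6 + 44 * s ^ 2 * j ^ 6 + 13 * s ^ 3 * j ^ 6 + 2 * j ^ 7 +
      3 * s * j ^ 7 + s ^ 2 * j ^ 7) := by
    rw [hw']
    unfold betaPoly
    field_simp
    ring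
  rw [key, neg_mul, neg_lt_zero]
  have hsj : 0 < s + j := by linarith
  refine mul_pos (by positivity) ?_
  rcases hs.eq_or_lt with rfl | hs0
  · have : 0 < j := by linarith
    simp only [ne_eq, OfNat.ofNat_ne_zero, not_false_eq_true, zero_pow, mul_zero, zero_mul,
      zero_add, add_zero]
    positivity
  · positivity

/-! ### The silver schedule in rational form -/

/-- A rational parametrization of `M` and `√(2 * M ^ 2 - 2 * M + 1)`. -/
theorem exists_rational_param {M : ℝ} (hM : 1 < M) :
    ∃ t : ℝ, 0 < t ∧ 0 < 1 - 2 * t - t ^ 2 ∧ M = (1 - t ^ 2) / (1 - 2 * t - t ^ 2) ∧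
      √(2 * M ^ 2 - 2 * M + 1) = (1 + t ^ 2) / (1 - 2 * t - t ^ 2) := by
  have hL : 0 < M - 1 := sub_pos.2 hM
  have hpos : 0 ≤ 2 * M ^ 2 - 2 * M + 1 := by nlinarith
  obtain ⟨S, hS⟩ : ∃ S, S = √(2 * M ^ 2 - 2 * M + 1) := ⟨_, rfl⟩
  have hS2 : S ^ 2 = 2 * M ^ 2 - 2 * M + 1 := by rw [hS, Real.sq_sqrt hpos]
  have hMS : M < S := by
    rw [hS]; exact Real.lt_sqrt_of_sq_lt (by nlinarith)
  rw [← hS]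
  -- The line of slope `1 + t` through the rational point `(1, 1)` of the conic `S ^ 2 = 2 * M ^ 2 -
  -- 2 * M + 1`.
  obtain ⟨t, ht⟩ : ∃ t, t = (S - M) / (M - 1) := ⟨_, rfl⟩
  have hSt : S = M + t * (M - 1) := by rw [ht, div_mul_cancel₀ _ hL.ne']; ring
  have ht0 : 0 < t := by rw [ht]; exact div_pos (sub_pos.2 hMS) hL
  have e1 : (M - 1) * (1 - 2 * t - t ^ 2) = 2 * t := by
    rw [hSt] at hS2
    refine mul_left_cancel₀ hL.ne' ?_
    linear_combination -hS2
  have hE : 0 < 1 - 2 * t - t ^ 2 :=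
    pos_of_mul_pos_right (by rw [e1]; positivity) hL.le
  refine ⟨t, ht0, hE, ?_, ?_⟩
  · rw [eq_div_iff hE.ne']; linear_combination e1
  · rw [eq_div_iff hE.ne', hSt]; linear_combination (1 + t) * e1

/-- The schedule for `v = 0` consists of the two-step silver stepsizes. -/
theorem isSchedule_silver {t : ℝ} (ht : 0 < t) (hE : 0 < 1 - 2 * t - t ^ 2)
    {n : ℕ} :
    IsSchedule ((1 - t ^ 2) / (1 - 2 * t - t ^ 2)) n 0 ((1 - 2 * t - t ^ 2) / (1 - t))
      ((1 - 2 * t - t ^ 2) / ((1 + t) * (1 - 2 * t))) := by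
  have n2 : 0 < 1 - 2 * t := by nlinarith
  have n1 : 0 < 1 - t := by linarith
  have n4 : 0 < 1 + t := by linarith
  have n5 : 0 < 1 - t ^ 2 := by nlinarith
  have e5 : 1 - t ^ 2 = (1 - t) * (1 + t) := by ring
  refine ⟨⟨?_, ?_⟩, ⟨?_, ?_⟩, ?_, ?_⟩
  · rw [one_div_div, e5]
    exact div_le_div_of_nonneg_left hE.le n1 (by nlinarith)
  · rw [div_lt_one n1]; nlinarith
  · rw [div_div_div_eq, div_lt_div_iff₀ (by positivity) (by positivity)]
    have : (1 - 2 * t - t ^ 2) * ((1 - t) * (1 - t ^ 2)) -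
        (1 - 2 * t - t ^ 2) * (1 - 2 * t - t ^ 2) * ((1 + t) * (1 - 2 * t)) =
        (1 - 2 * t - t ^ 2) * (1 + t) * (2 * t * (1 - t - t ^ 2)) := by ring
    have h2 : 0 < (1 - 2 * t - t ^ 2) * (1 + t) * (2 * t * (1 - t - t ^ 2)) := by
      have : 0 < 1 - t - t ^ 2 := by linarith
      positivity
    linarith
  · have : ((1 - t ^ 2) / (1 - 2 * t - t ^ 2) + 1) / (2 * ((1 - t ^ 2) / (1 - 2 * t - t ^ 2))) =
        (1 - t - t ^ 2) / (1 - t ^ 2) := by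
      have n3 := hE.ne'
      have n5' := n5.ne'
      generalize hE' : 1 - 2 * t - t ^ 2 = E at n3 ⊢
      generalize h5 : 1 - t ^ 2 = F at n5' ⊢
      field_simp
      subst hE' h5
      ring
    rw [this, div_lt_div_iff₀ (by positivity) n5]
    have : (1 - t - t ^ 2) * ((1 + t) * (1 - 2 * t)) - (1 - 2 * t - t ^ 2) * (1 - t ^ 2) =
      t ^ 2 * (1 + t) * t := by ring
    have : 0 < t ^ 2 * (1 + t) * t := by positivity
    linarith
  · have n1 := n1.ne'
    have n3 := hE.ne'
    unfold alphaPoly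
    generalize hE' : 1 - 2 * t - t ^ 2 = E at n3 ⊢
    generalize ho : 1 - t = o at n1 ⊢
    field_simp
    subst hE' ho
    ring
  · have n1 := n1.ne'
    have n2 := n2.ne'
    have n3 := hE.ne'
    unfold betaPoly
    generalize hE' : 1 - 2 * t - t ^ 2 = E at n3 ⊢
    generalize hp : 1 - 2 * t = p at n2 ⊢
    generalize ho : 1 - t = o at n1 ⊢
    field_simp
    subst hE' hp ho
    ring

/-- Here `t / (1 - t - t ^ 2)` is `(M - 1) / (M + 1)`, the one-step rate for `2 / (M + 1)`. The gap
comes from `(1 - 2 * t) - (1 - t - t ^ 2) ^ 2 = t ^ 2 * (1 - 2 * t - t ^ 2)`. -/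
theorem silver_rate_lt {t : ℝ} (ht : 0 < t) (hE : 0 < 1 - 2 * t - t ^ 2) :
    t ^ 2 / (1 - 2 * t) < (t / (1 - t - t ^ 2)) ^ 2 := by
  have n2 : 0 < 1 - 2 * t := by nlinarith
  have n6 : 0 < 1 - t - t ^ 2 := by linarith
  rw [div_pow, div_lt_div_iff₀ n2 (by positivity)]
  have : 0 < t ^ 2 * (t ^ 2 * (1 - 2 * t - t ^ 2)) := by positivity
  nlinarith

theorem ratioBound_eq {t : ℝ} (ht : 0 < t) (hE : 0 < 1 - 2 * t - t ^ 2)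
    (hS : √(2 * ((1 - t ^ 2) / (1 - 2 * t - t ^ 2)) ^ 2 - 2 * ((1 - t ^ 2) / (1 - 2 * t - t ^ 2)) + 1)
      = (1 + t ^ 2) / (1 - 2 * t - t ^ 2)) :
    ratioBound ((1 - t ^ 2) / (1 - 2 * t - t ^ 2)) =
      1 / 2 + 1 / 2 * ((t ^ 2 / (1 - 2 * t)) ^ 2 / (t / (1 - t - t ^ 2)) ^ 4) := by
  have n2 : 0 < 1 - 2 * t := by nlinarith
  have n6 : 0 < 1 - t - t ^ 2 := by linarith
  have e1 : (1 - t ^ 2) / (1 - 2 * t - t ^ 2) - 1 = 2 * t / (1 - 2 * t - t ^ 2) := by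
    rw [eq_div_iff hE.ne', sub_mul, div_mul_cancel₀ _ hE.ne']; ring
  have e2 : (1 - t ^ 2) / (1 - 2 * t - t ^ 2) + 1 =
      2 * (1 - t - t ^ 2) / (1 - 2 * t - t ^ 2) := by
    rw [eq_div_iff hE.ne', add_mul, div_mul_cancel₀ _ hE.ne']; ring
  have e3 : (1 + t ^ 2) / (1 - 2 * t - t ^ 2) - (1 - t ^ 2) / (1 - 2 * t - t ^ 2) =
      2 * t ^ 2 / (1 - 2 * t - t ^ 2) := by
    rw [← sub_div]; ring
  have e4 : 2 + (1 + t ^ 2) / (1 - 2 * t - t ^ 2) - (1 - t ^ 2) / (1 - 2 * t - t ^ 2) =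
      2 * (1 - 2 * t) / (1 - 2 * t - t ^ 2) := by
    rw [add_sub_assoc, e3, eq_div_iff hE.ne', add_mul, div_mul_cancel₀ _ hE.ne']; ring
  rw [ratioBound, hS, e1, e2, e3, e4]
  have n2 := n2.ne'
  have n3 := hE.ne'
  have n6 := n6.ne'
  generalize hE' : 1 - 2 * t - t ^ 2 = E at n3 ⊢
  generalize hp : 1 - 2 * t = p at n2 ⊢
  generalize ho : 1 - t - t ^ 2 = o at n6 ⊢
  field_simp

/-! ### Existence and uniqueness of the schedule -/

/-- For every admissible `v` there is exactly one stepsize schedule. -/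
theorem existsUnique_isSchedule {M : ℝ} (hM : 1 < M) {n : ℕ} (hn : 1 ≤ n) {v : ℝ}
    (hv : v ∈ admissible M n) : ∃! p : ℝ × ℝ, IsSchedule M n v p.1 p.2 := by
  have hM0 : 0 < M := zero_lt_one.trans hM
  have hL : 0 < M - 1 := sub_pos.2 hM
  have hn1 : (1 : ℝ) ≤ n := by exact_mod_cast hn
  have hn0 : (n : ℝ) ≠ 0 := by positivity
  obtain ⟨w, hwdef⟩ : ∃ w, w = ((n : ℝ) - 1) * v / n := ⟨_, rfl⟩
  have hw0 : 0 ≤ w := by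
    rw [hwdef]; exact div_nonneg (mul_nonneg (sub_nonneg.2 hn1) hv.1) (by positivity)
  have hw1 : w * M ≤ M - 1 := by
    rcases eq_or_ne n 1 with rfl | hne
    · simp [hwdef, hL.le]
    · have h2 : 0 < (n : ℝ) - 1 := by
        have : 1 < n := lt_of_le_of_ne hn hne.symm
        exact sub_pos.2 (by exact_mod_cast this)
      have h3 := (le_div_iff₀ (by positivity)).1 (hv.2 hne)
      rw [hwdef, div_mul_eq_mul_div, div_le_iff₀ (by positivity)]
      linarith
  have hα : ∀ α, alphaPoly M n v α = 0 ↔ alphaPoly M 2 (2 * w) α = 0 := fun α => by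
    rw [alphaPoly_eq _ _ _ _ hn0, ← hwdef]; simp [hn0]
  have hβ : ∀ α β, betaPoly M n v α β = 0 ↔ betaPoly M 2 (2 * w) α β = 0 := fun α β => by
    rw [betaPoly_eq _ _ _ _ _ hn0, ← hwdef]; simp [hn0]
  obtain ⟨α, hαm, hα0⟩ : ∃ α ∈ Set.Ico (1 / M) 1, alphaPoly M 2 (2 * w) α = 0 := by
    -- For `w = 0` the cubic vanishes at `1`, which is excluded, so a sign change is not available
    -- and the silver stepsize serves as root. For `w > 0` it is negative at `1`, and nonnegative at
    -- `1 / M` exactly when `w * M ≤ M - 1`.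
    rcases hw0.eq_or_lt with rfl | hwpos
    · obtain ⟨t, ht, hE, rfl, -⟩ := exists_rational_param hM
      have h := isSchedule_silver ht hE (n := 2)
      exact ⟨_, h.alpha_mem, by simpa using h.alpha_eq⟩
    · have h1 : alphaPoly M 2 (2 * w) 1 < 0 := by
        have : alphaPoly M 2 (2 * w) 1 = -(2 * (M - 1) * w) := by unfold alphaPoly; ring
        rw [this, neg_lt_zero]; positivity
      have h2 : 0 ≤ alphaPoly M 2 (2 * w) (1 / M) := by
        have : alphaPoly M 2 (2 * w) (1 / M) = 2 * (M - 1) / M ^ 2 * (M - 1 - w * M) := by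
          unfold alphaPoly; field_simp; ring
        rw [this]
        exact mul_nonneg (by positivity) (sub_nonneg.2 hw1)
      have hle : 1 / M ≤ 1 := by rw [div_le_one hM0]; exact hM.le
      obtain ⟨α, h, e⟩ := intermediate_value_Ico' (f := alphaPoly M 2 (2 * w)) hle
        (by unfold alphaPoly; fun_prop) ⟨h1, h2⟩
      exact ⟨α, h, e⟩
  have huniq : ∀ x y, x ∈ Set.Ico (1 / M) 1 → y ∈ Set.Ico (1 / M) 1 →
      alphaPoly M 2 (2 * w) x = 0 → alphaPoly M 2 (2 * w) y = 0 → ¬ x < y := by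
    intro x y hx hy ex ey hxy
    refine cubic_root_unique (A := (M - 1) * M * 2) (B := (M + 1) * (M - 2) * 2)
      (C := 4 * 2 + (M - 1) * (2 - 1) * (2 * w)) (D := 2 * 2) (by positivity) (by norm_num) ?_
      ((by positivity : 0 < 1 / M).trans_le hx.1) hxy hy.2 ex ey
    have := mul_nonneg hL.le hw0
    linarith
  have hα_pos : 0 < α := (by positivity : 0 < 1 / M).trans_le hαm.1
  obtain ⟨β, ⟨hβm, hβ0⟩, hβu⟩ : ∃! β, β ∈ Set.Ioo (α / M) ((M + 1) / (2 * M)) ∧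
      betaPoly M 2 (2 * w) α β = 0 := by
    have hA : 0 < M * 2 * ((-1 + M) ^ 2 * 2 + (1 + M) ^ 2 * (-1 + 2) * (2 * w)) *
        ((-1 + M) * α + (1 + M)) := by
      have : 0 < -1 + M := by linarith
      have : 0 ≤ (1 + M) ^ 2 * (-1 + 2) * (2 * w) := mul_nonneg (by positivity) (by positivity)
      positivity
    refine existsUnique_quadratic_root hA ?_ (betaPoly_lower_neg hM hαm.1 hαm.2 hw0 hα0) ?_
    · rw [div_lt_div_iff₀ hM0 (by positivity)]
      nlinarith [hαm.2]
    · refine lt_of_lt_of_eq ?_ (betaPoly_upper hM hα0).symm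
      positivity
  refine ⟨(α, β), ⟨hαm, hβm, (hα α).2 hα0, (hβ α β).2 hβ0⟩, ?_⟩
  rintro ⟨x, y⟩ ⟨hx, hy, ex, ey⟩
  have hxα : x = α := by
    rcases lt_trichotomy x α with h | h | h
    · exact (huniq _ _ hx hαm ((hα x).1 ex) hα0 h).elim
    · exact h
    · exact (huniq _ _ hαm hx hα0 ((hα x).1 ex) h).elim
  simp only at hxα hy ey
  subst hxα
  rw [hβu y ⟨hy, (hβ _ _).1 ey⟩]

/-! ### Effect of the noise and bounds on the worst case -/

section Noise

variable {d n : ℕ} {m M σ α β : ℝ} {f : Vec d → ℝ} {g : Vec d → Fin n → Vec d}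

/-- Bias-variance decomposition of one stochastic gradient step. -/
theorem IsStochasticOracle.mean_sq_step_le (hn : 1 ≤ n) (hg : IsStochasticOracle σ f g) (β : ℝ)
    (x c : Vec d) :
    (1 / (n : ℝ)) * ∑ j, ‖sgStep g β x j - c‖ ^ 2 ≤
      ‖x - β • gradient f x - c‖ ^ 2 + β ^ 2 * σ ^ 2 := by
  have hn0 : (n : ℝ) ≠ 0 := by positivity
  have hsum : ∑ j, (g x j - gradient f x) = 0 := by
    have h := hg.unbiased x
    rw [Finset.sum_sub_distrib, Finset.sum_const, Finset.card_univ, Fintype.card_fin, ← h,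
      ← Nat.cast_smul_eq_nsmul ℝ, smul_smul, mul_one_div_cancel hn0, one_smul, sub_self]
  have e : ∀ j, ‖sgStep g β x j - c‖ ^ 2 = ‖x - β • gradient f x - c‖ ^ 2
      - 2 * β * inner ℝ (x - β • gradient f x - c) (g x j - gradient f x)
      + β ^ 2 * ‖g x j - gradient f x‖ ^ 2 := fun j => by
    have : sgStep g β x j - c = (x - β • gradient f x - c) - β • (g x j - gradient f x) := by
      unfold sgStep; module
    rw [this, norm_sub_sq_real, real_inner_smul_right, norm_smul, mul_pow, Real.norm_eq_abs, sq_abs]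
    ring
  have hs : ∑ j, ‖sgStep g β x j - c‖ ^ 2 = n * ‖x - β • gradient f x - c‖ ^ 2
      + β ^ 2 * ∑ j, ‖g x j - gradient f x‖ ^ 2 := by
    simp only [e]
    rw [Finset.sum_add_distrib, Finset.sum_sub_distrib, ← Finset.mul_sum, ← Finset.mul_sum,
      ← inner_sum, hsum, inner_zero_right]
    simp
  rw [hs, mul_add, ← mul_assoc, one_div_mul_cancel hn0, one_mul]
  have := mul_le_mul_of_nonneg_left (hg.variance x) (sq_nonneg β)
  linarith

/-- The deterministic gradient step is Lipschitz. -/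
theorem IsSmoothStronglyConvex.norm_step_sub_step_le (hf : IsSmoothStronglyConvex m M f)
    (hβ : 0 ≤ β) (x y : Vec d) :
    ‖(x - β • gradient f x) - (y - β • gradient f y)‖ ≤ (1 + β * M) * ‖x - y‖ := by
  have e : (x - β • gradient f x) - (y - β • gradient f y)
      = (x - y) - β • (gradient f x - gradient f y) := by module
  rw [e]
  refine (norm_sub_le _ _).trans ?_
  rw [norm_smul, Real.norm_of_nonneg hβ]
  have := mul_le_mul_of_nonneg_left (hf.lipschitz x y) hβ
  linarith

/-- The expected error exceeds a multiple of the error of the noiseless method, which is close to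
`1`, by at most a multiple of the noise level. -/
theorem expectedError_le (hn : 1 ≤ n) (hf : IsSmoothStronglyConvex m M f)
    (hg : IsStochasticOracle σ f g) (hβ : 0 ≤ β) {ε : ℝ} (hε : 0 < ε)
    {x₀ x₁ xs : Vec d} (hx₁ : x₁ = x₀ - α • gradient f x₀) :
    expectedError g α β x₀ xs ≤ (1 + ε) * ‖x₁ - β • gradient f x₁ - xs‖ ^ 2
      + ((1 + 1 / ε) * ((1 + β * M) * α) ^ 2 + β ^ 2) * σ ^ 2 := by
  have hn0 : (n : ℝ) ≠ 0 := by positivity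
  set A := ‖x₁ - β • gradient f x₁ - xs‖ with hA
  have step : ∀ i, (1 / (n : ℝ)) * ∑ j, ‖sgStep g β (sgStep g α x₀ i) j - xs‖ ^ 2 ≤
      (1 + ε) * A ^ 2 + β ^ 2 * σ ^ 2
      + (1 + 1 / ε) * ((1 + β * M) * α) ^ 2 * ‖g x₀ i - gradient f x₀‖ ^ 2 := fun i => by
    refine (hg.mean_sq_step_le hn β _ _).trans ?_
    set y := sgStep g α x₀ i with hy
    set B := (1 + β * M) * ‖y - x₁‖ with hB
    have hyx : ‖y - x₁‖ ^ 2 = α ^ 2 * ‖g x₀ i - gradient f x₀‖ ^ 2 := by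
      have : y - x₁ = -(α • (g x₀ i - gradient f x₀)) := by
        rw [hy, hx₁]; unfold sgStep; module
      rw [this, norm_neg, norm_smul, mul_pow, Real.norm_eq_abs, sq_abs]
    have htri : ‖y - β • gradient f y - xs‖ ≤ A + B := by
      have e : y - β • gradient f y - xs = (x₁ - β • gradient f x₁ - xs)
          + ((y - β • gradient f y) - (x₁ - β • gradient f x₁)) := by abel
      rw [e]
      exact (norm_add_le _ _).trans (add_le_add le_rfl (hf.norm_step_sub_step_le hβ y x₁))
    have hsq : ‖y - β • gradient f y - xs‖ ^ 2 ≤ (A + B) ^ 2 :=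
      pow_le_pow_left₀ (norm_nonneg _) htri 2
    -- Young's inequality keeps the factor of the noiseless error near `1`; the constant on `B ^ 2`
    -- may be crude, as it only affects the noise threshold.
    have hyoung : (A + B) ^ 2 ≤ (1 + ε) * A ^ 2 + (1 + 1 / ε) * B ^ 2 := by
      have : (1 + ε) * A ^ 2 + (1 + 1 / ε) * B ^ 2 - (A + B) ^ 2 = (ε * A - B) ^ 2 / ε := by
        field_simp; ring
      have : 0 ≤ (ε * A - B) ^ 2 / ε := by positivity
      linarith
    have hB2 : B ^ 2 = ((1 + β * M) * α) ^ 2 * ‖g x₀ i - gradient f x₀‖ ^ 2 := by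
      rw [hB, mul_pow, hyx]; ring
    rw [hB2] at hyoung
    linarith
  have hsum := Finset.sum_le_sum fun i (_ : i ∈ Finset.univ) => step i
  rw [← Finset.mul_sum, Finset.sum_add_distrib, ← Finset.mul_sum, Finset.sum_const,
    Finset.card_univ, Fintype.card_fin, nsmul_eq_mul] at hsum
  have hsum' := mul_le_mul_of_nonneg_left hsum (show 0 ≤ 1 / (n : ℝ) by positivity)
  have hvar := mul_le_mul_of_nonneg_left (hg.variance x₀)
    (show 0 ≤ (1 + 1 / ε) * ((1 + β * M) * α) ^ 2 by positivity)
  rw [mul_add, ← mul_assoc _ (n : ℝ), one_div_mul_cancel hn0, one_mul] at hsum'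
  have e : expectedError g α β x₀ xs = 1 / (n : ℝ) *
      (1 / (n : ℝ) * ∑ i, ∑ j, ‖sgStep g β (sgStep g α x₀ i) j - xs‖ ^ 2) := by
    unfold expectedError; ring
  rw [e]
  refine hsum'.trans ?_
  rw [mul_left_comm]
  linarith

/-- Makes the supremum in `worstCase` genuine: `sSup` of an unbounded set of reals is `0`. The bound
takes `ε = 1` and uses that `xs` is fixed by gradient steps. -/
theorem bddAbove_errorValues (hn : 1 ≤ n) (hM : 0 ≤ M) {R : ℝ} (hR : 0 ≤ R)
    (hα : 0 ≤ α) (hβ : 0 ≤ β) : BddAbove (errorValues d n m M R σ α β) := by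
  refine ⟨(1 + 1) * ((1 + β * M) * ((1 + α * M) * R)) ^ 2
      + ((1 + 1 / 1) * ((1 + β * M) * α) ^ 2 + β ^ 2) * σ ^ 2, ?_⟩
  rintro e ⟨f, g, x₀, xs, hf, hg, hxs, hR0, rfl⟩
  refine (expectedError_le hn hf hg hβ one_pos rfl).trans ?_
  have hd : ‖x₀ - xs‖ ≤ R := le_of_sq_le_sq hR0 hR
  have h1 := hf.norm_step_sub_step_le hα x₀ xs
  rw [hxs, smul_zero, sub_zero] at h1
  have h2 := hf.norm_step_sub_step_le hβ (x₀ - α • gradient f x₀) xs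
  rw [hxs, smul_zero, sub_zero] at h2
  have h3 := h2.trans (mul_le_mul_of_nonneg_left (h1.trans
    (mul_le_mul_of_nonneg_left hd (show 0 ≤ 1 + α * M by positivity)))
    (show 0 ≤ 1 + β * M by positivity))
  have h4 := pow_le_pow_left₀ (norm_nonneg _) h3 2
  linarith

theorem hasGradientAt_half_norm_sq (x : Vec d) :
    HasGradientAt (fun x : Vec d => 1 / 2 * ‖x‖ ^ 2) x x := by
  rw [hasGradientAt_iff_hasFDerivAt]
  refine ((hasStrictFDerivAt_norm_sq x).hasFDerivAt.const_mul (1 / 2 : ℝ)).congr_fderiv ?_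
  ext y
  simp

theorem isSmoothStronglyConvex_half_norm_sq (hM : 1 ≤ M) :
    IsSmoothStronglyConvex 1 M (fun x : Vec d => 1 / 2 * ‖x‖ ^ 2) where
  differentiable x := (hasGradientAt_half_norm_sq x).differentiableAt
  strong x y := by
    rw [(hasGradientAt_half_norm_sq x).gradient, norm_sub_sq_real, inner_sub_right,
      real_inner_self_eq_norm_sq, real_inner_comm x y]
    linarith
  lipschitz x y := by
    rw [(hasGradientAt_half_norm_sq x).gradient, (hasGradientAt_half_norm_sq y).gradient]
    exact le_mul_of_one_le_left (norm_nonneg _) hM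

/-- The quadratic `‖·‖ ^ 2 / 2` with exact gradients, seen as an instance of the problem. -/
theorem quadratic_mem_errorValues (hd : 1 ≤ d) (hn : 1 ≤ n) (hM : 1 ≤ M) (R σ α β : ℝ) :
    ((1 - β) * (1 - α) * R) ^ 2 ∈ errorValues d n 1 M R σ α β := by
  have hn0 : (n : ℝ) ≠ 0 := by positivity
  have hnorm : ‖(EuclideanSpace.single (⟨0, hd⟩ : Fin d) R : Vec d)‖ ^ 2 = R ^ 2 := by
    rw [PiLp.norm_single, Real.norm_eq_abs, sq_abs]
  refine ⟨fun x => 1 / 2 * ‖x‖ ^ 2, fun x _ => x, EuclideanSpace.single ⟨0, hd⟩ R, 0,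
    isSmoothStronglyConvex_half_norm_sq hM, ⟨fun x => ?_, fun x => ?_⟩, ?_, ?_, ?_⟩
  · rw [(hasGradientAt_half_norm_sq x).gradient, Finset.sum_const, Finset.card_univ,
      Fintype.card_fin, ← Nat.cast_smul_eq_nsmul ℝ, smul_smul, one_div_mul_cancel hn0, one_smul]
  · rw [(hasGradientAt_half_norm_sq x).gradient]
    simpa using sq_nonneg σ
  · exact (hasGradientAt_half_norm_sq 0).gradient
  · rw [sub_zero, hnorm]
  · have e : ∀ x : Vec d, x - α • x - β • (x - α • x) - 0 = ((1 - β) * (1 - α)) • x := fun x => by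
      module
    simp only [expectedError, sgStep, e, norm_smul, mul_pow, hnorm, Real.norm_eq_abs, sq_abs,
      abs_mul, Finset.sum_const, Finset.card_univ, Fintype.card_fin, nsmul_eq_mul]
    field_simp

end Noise

end SilverSGD

/-! ### The comparison with constant stepsizes -/

theorem theorem3 (M : ℝ) (hM : 1 < M) (n : ℕ) (hn : 1 ≤ n) :
    (∀ v ∈ SilverSGD.admissible M n, ∃! p : ℝ × ℝ, SilverSGD.IsSchedule M n v p.1 p.2) ∧
    SilverSGD.ratioBound M < 1 ∧
    ∃ U : ℝ, 0 < U ∧ ∀ R σ : ℝ, 0 < R → 0 < σ → σ / R < √U →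
      ∃ v ∈ SilverSGD.admissible M n, ∃ α β : ℝ, SilverSGD.IsSchedule M n v α β ∧
        ∀ d : ℕ, 1 ≤ d →
          BddAbove (SilverSGD.errorValues d n 1 M R σ α β) ∧
          BddAbove (SilverSGD.errorValues d n 1 M R σ (2 / (M + 1)) (2 / (M + 1))) ∧
          0 < SilverSGD.worstCase d n 1 M R σ (2 / (M + 1)) (2 / (M + 1)) ∧
          SilverSGD.worstCase d n 1 M R σ α β /
              SilverSGD.worstCase d n 1 M R σ (2 / (M + 1)) (2 / (M + 1))
            ≤ SilverSGD.ratioBound M := by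
  open SilverSGD in
  refine ⟨fun v hv => existsUnique_isSchedule hM hn hv, ?_⟩
  have hM0 : 0 < M := zero_lt_one.trans hM
  obtain ⟨t, ht, hE, hMt, hS⟩ := exists_rational_param hM
  have hn1 : (1 : ℝ) ≤ n := by exact_mod_cast hn
  have n2 : 0 < 1 - 2 * t := by nlinarith
  have n6 : 0 < 1 - t - t ^ 2 := by linarith
  have hsch := isSchedule_silver ht hE (n := n)
  have hratio := ratioBound_eq ht hE (by rw [← hMt]; exact hS)
  have hrate := silver_rate_lt ht hE
  have hq : 1 - 2 / (M + 1) = t / (1 - t - t ^ 2) := by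
    have e : M + 1 = 2 * (1 - t - t ^ 2) / (1 - 2 * t - t ^ 2) := by
      rw [hMt, eq_div_iff hE.ne', add_mul, div_mul_cancel₀ _ hE.ne']; ring
    rw [e, div_div_eq_mul_div, mul_div_mul_left _ _ two_ne_zero, eq_div_iff n6.ne', sub_mul,
      div_mul_cancel₀ _ n6.ne']
    ring
  have hcontr : ∀ {d : ℕ} {f : Vec d → ℝ} {xs x₀ : Vec d}, IsSmoothStronglyConvex 1 M f →
      gradient f xs = 0 → _ := fun {d f xs x₀} hf hxs =>
    IsSmoothStronglyConvex.norm_two_steps_le ht hE (hMt ▸ hf) hxs (x₀ := x₀) rfl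
  rw [← hMt] at hsch hratio
  obtain ⟨ρ, hρ⟩ : ∃ ρ, ρ = t ^ 2 / (1 - 2 * t) := ⟨_, rfl⟩
  obtain ⟨q, hqd⟩ : ∃ q, q = t / (1 - t - t ^ 2) := ⟨_, rfl⟩
  obtain ⟨α, hα⟩ : ∃ α, α = (1 - 2 * t - t ^ 2) / (1 - t) := ⟨_, rfl⟩
  obtain ⟨β, hβ⟩ : ∃ β, β = (1 - 2 * t - t ^ 2) / ((1 + t) * (1 - 2 * t)) := ⟨_, rfl⟩
  rw [← hα, ← hβ] at hsch
  simp only [← hα, ← hβ, ← hρ] at hcontr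
  rw [← hρ, ← hqd] at hratio hrate
  rw [← hqd] at hq
  have hρ0 : 0 < ρ := by rw [hρ]; positivity
  have hq0 : 0 < q := by rw [hqd]; positivity
  clear hα hβ hρ hqd hMt hS ht hE n2 n6
  have hlt : ρ ^ 2 < q ^ 4 := by
    calc ρ ^ 2 < (q ^ 2) ^ 2 := pow_lt_pow_left₀ hrate hρ0.le two_ne_zero
      _ = q ^ 4 := by ring
  have hα0 : 0 < α := (by positivity : 0 < 1 / M).trans_le hsch.alpha_mem.1
  have hβ0 : 0 < β := (by positivity : 0 < α / M).trans hsch.beta_mem.1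
  have hs0 : 0 ≤ 2 / (M + 1) := by positivity
  refine ⟨?_, ?_⟩
  · have : ρ ^ 2 / q ^ 4 < 1 := (div_lt_one (by positivity)).2 hlt
    linarith
  -- Half of the gap `q ^ 4 - ρ ^ 2` may be lost: `ε` spends one quarter in Young's inequality, and
  -- the threshold `(q ^ 4 - ρ ^ 2) / (4 * C)` leaves one quarter for the noise.
  obtain ⟨ε, hε⟩ : ∃ ε, ε = (q ^ 4 - ρ ^ 2) / (4 * ρ ^ 2) := ⟨_, rfl⟩
  have hgap : 0 < q ^ 4 - ρ ^ 2 := sub_pos.2 hlt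
  have hε0 : 0 < ε := by rw [hε]; positivity
  have hερ : ε * ρ ^ 2 = (q ^ 4 - ρ ^ 2) / 4 := by rw [hε]; field_simp
  obtain ⟨C, hC⟩ : ∃ C, C = (1 + 1 / ε) * ((1 + β * M) * α) ^ 2 + β ^ 2 := ⟨_, rfl⟩
  have hC0 : 0 < C := by rw [hC]; positivity
  refine ⟨(q ^ 4 - ρ ^ 2) / (4 * C), by positivity, fun R σ hR hσ hσR => ?_⟩
  have hnoise : C * σ ^ 2 ≤ (q ^ 4 - ρ ^ 2) / 4 * R ^ 2 := by
    have h := ((Real.lt_sqrt (by positivity)).1 hσR).le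
    rw [div_pow, div_le_div_iff₀ (by positivity) (by positivity)] at h
    linarith
  refine ⟨0, ⟨le_rfl, fun _ => div_nonneg (mul_nonneg (by linarith) (by positivity))
    (mul_nonneg (by linarith) hM0.le)⟩, α, β, hsch, fun d hd => ?_⟩
  have hbdd := bddAbove_errorValues (d := d) (m := 1) (σ := σ) hn hM0.le hR.le hs0 hs0
  have hden : q ^ 4 * R ^ 2 ≤ worstCase d n 1 M R σ (2 / (M + 1)) (2 / (M + 1)) := by
    refine le_csSup hbdd ?_
    have h := quadratic_mem_errorValues hd hn hM.le R σ (2 / (M + 1)) (2 / (M + 1))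
    rw [hq] at h
    convert h using 1
    ring
  have hden0 : 0 < worstCase d n 1 M R σ (2 / (M + 1)) (2 / (M + 1)) :=
    lt_of_lt_of_le (by positivity) hden
  refine ⟨bddAbove_errorValues hn hM0.le hR.le hα0.le hβ0.le, hbdd, hden0, ?_⟩
  rw [div_le_iff₀ hden0]
  have hnum : worstCase d n 1 M R σ α β ≤ (q ^ 4 + ρ ^ 2) / 2 * R ^ 2 := by
    refine Real.sSup_le ?_ (by positivity)
    rintro e ⟨f, g, x₀, xs, hf, hg, hxs, hR0, rfl⟩
    refine (expectedError_le hn hf hg hβ0.le hε0 rfl).trans ?_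
    rw [← hC]
    have h1 := pow_le_pow_left₀ (norm_nonneg _) (hcontr (x₀ := x₀) hf hxs) 2
    rw [mul_pow] at h1
    have h2 := h1.trans (mul_le_mul_of_nonneg_left hR0 (sq_nonneg ρ))
    have h3 := mul_le_mul_of_nonneg_left h2 (show 0 ≤ 1 + ε by positivity)
    have h4 : (1 + ε) * (ρ ^ 2 * R ^ 2) = ρ ^ 2 * R ^ 2 + (q ^ 4 - ρ ^ 2) / 4 * R ^ 2 := by
      rw [← hερ]; ring
    have h5 := mul_pos hgap (pow_pos hR 2)
    linarith
  have hbound : ratioBound M * (q ^ 4 * R ^ 2) = (q ^ 4 + ρ ^ 2) / 2 * R ^ 2 := by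
    rw [hratio]; field_simp
  have hrb : 0 ≤ ratioBound M := by rw [hratio]; positivity
  calc _ ≤ _ := hnum
    _ = _ := hbound.symm
    _ ≤ _ := mul_le_mul_of_nonneg_left hden hrb
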